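/- Let $B_1=\{z\in\mathbb R^2:|z|<1\}$, $S_1=\partial B_1$ and $e_1=(1,0)$. Let $v\in W^{1,2}(B_1;\mathbb R^2)$ and let $p\in L^1_{loc}(B_1)$ have a weak gradient $\nabla p\in L^1_{loc}(B_1;\mathbb R^2)$, such that $$(v\cdot\nabla)v+\nabla p=0\quad\text{and}\quad \operatorname{div}v=0\quad\text{a.e. in }B_1,\qquad v=e_1\ \text{ on }S_1,$$ where the boundary condition is understood in the sense of traces, i.e. $v-e_1\in W^{1,2}_0(B_1;\mathbb R^2)$ (the closure of $C_c^\infty(B_1;\mathbb R^2)$ in $W^{1,2}$). Then $\nabla p\in L^1(B_1)$, the distributional Laplacian $\Delta p$ is a function in $L^1(B_1)$, and $p$ satisfies the homogeneous Neumann boundary condition on $S_1$ in the weak sense: for every $\varphi\in C^\infty(\overline{B}_1)$, $$\int_{B_1}\nabla p\cdot\nabla\varphi=-\int_{B_1}(\Delta p)\,\varphi .$$ -/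

import Mathlib

open MeasureTheory Filter Topology
open scoped ContDiff

noncomputable section

namespace EulerDisk

/-- The Euclidean plane. -/
abbrev Plane : Type := EuclideanSpace ℝ (Fin 2)

/-- The open unit disk `B₁`. -/
def disk : Set Plane := Metric.ball 0 1

/-- The unit vector `e₁ = (1, 0)`. -/
def e₁ : Plane := EuclideanSpace.single 0 1

/-- The classical partial derivative `∂ⱼ φ`. -/
def pderiv (j : Fin 2) (φ : Plane → ℝ) (x : Plane) : ℝ :=
  fderiv ℝ φ x (EuclideanSpace.single j 1)

/-- `φ ∈ C_c^∞(B₁)`. -/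
structure IsTestFunction (φ : Plane → ℝ) : Prop where
  smooth : ContDiff ℝ ∞ φ
  compact : HasCompactSupport φ
  support : tsupport φ ⊆ disk

/-- `g` is the weak partial derivative `∂ⱼ f` in `B₁`, both functions being in `L¹_loc(B₁)`. -/
structure HasWeakPDeriv (j : Fin 2) (f g : Plane → ℝ) : Prop where
  locInt : LocallyIntegrableOn f disk
  locInt_deriv : LocallyIntegrableOn g disk
  byParts : ∀ φ : Plane → ℝ, IsTestFunction φ →
    ∫ x in disk, f x * pderiv j φ x = - ∫ x in disk, g x * φ x

/-- `g` is the weak Laplacian `Δ f` in `B₁`, both functions being in `L¹_loc(B₁)`. -/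
structure HasWeakLaplacian (f g : Plane → ℝ) : Prop where
  locInt : LocallyIntegrableOn f disk
  locInt_laplacian : LocallyIntegrableOn g disk
  byParts : ∀ φ : Plane → ℝ, IsTestFunction φ →
    ∫ x in disk, f x * Laplacian.laplacian φ x = ∫ x in disk, g x * φ x

/-- `f ∈ W^{1,2}(B₁)` with weak partial derivatives `Df 0`, `Df 1`. -/
structure IsW12 (f : Plane → ℝ) (Df : Fin 2 → Plane → ℝ) : Prop where
  memLp : MemLp f 2 (volume.restrict disk)
  memLp_deriv : ∀ j, MemLp (Df j) 2 (volume.restrict disk)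
  weakDeriv : ∀ j, HasWeakPDeriv j f (Df j)

/-- `f ∈ W^{1,2}_0(B₁)`, the closure of `C_c^∞(B₁)` in `W^{1,2}(B₁)`; the weak partial
derivatives of `f` are `Df 0`, `Df 1`. -/
structure IsW12Zero (f : Plane → ℝ) (Df : Fin 2 → Plane → ℝ) : Prop where
  isW12 : IsW12 f Df
  approx : ∃ ψ : ℕ → Plane → ℝ, (∀ n, IsTestFunction (ψ n)) ∧
    Tendsto (fun n => eLpNorm (fun x => ψ n x - f x) 2 (volume.restrict disk)) atTop (𝓝 0) ∧
    ∀ j, Tendsto (fun n => eLpNorm (fun x => pderiv j (ψ n) x - Df j x) 2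
      (volume.restrict disk)) atTop (𝓝 0)

/-- `(v, p)` is a solution of the stationary Euler system in `B₁` with `v ∈ W^{1,2}(B₁)` and
`v = e₁` on the unit circle. Here `Dv x i j` is the weak derivative `∂ⱼ vᵢ` and `Dp x j` is the
weak derivative `∂ⱼ p`; the pressure is only asked to be in `W^{1,1}_loc(B₁)`. -/
structure IsEulerSolution (v : Plane → Plane) (Dv : Plane → Matrix (Fin 2) (Fin 2) ℝ)
    (p : Plane → ℝ) (Dp : Plane → Plane) : Prop where
  velocity : ∀ i, IsW12 (fun x => v x i) (fun j x => Dv x i j)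
  pressure : ∀ j, HasWeakPDeriv j p (fun x => Dp x j)
  /-- `(v · ∇) v + ∇ p = 0` almost everywhere. -/
  momentum : ∀ᵐ x ∂(volume.restrict disk), ∀ i, ∑ j, v x j * Dv x i j + Dp x i = 0
  /-- `div v = 0` almost everywhere. -/
  divFree : ∀ᵐ x ∂(volume.restrict disk), ∑ i, Dv x i i = 0
  /-- `v = e₁` on the unit circle, that is, `v - e₁` has zero trace. -/
  boundary : ∀ i, IsW12Zero (fun x => v x i - e₁ i) (fun j x => Dv x i j)

end EulerDisk

end

open EulerDisk

namespace EulerDisk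

/-! For smooth `f`, `g`, `φ`, symmetry of second derivatives makes `∂ᵢ(φ f ∂ⱼg) - ∂ⱼ(φ f ∂ᵢg)` an
expression in first derivatives only. Its integral vanishes if `g` is constant near the circle,
because then `∂g` has compact support. All its terms are continuous in `W^{1,2}`, so density gives
`setIntegral_jacobian` for constant traces, with `φ` not required to vanish on the circle. Taking `f
= vⱼ`, `g = vᵢ` and summing over `i, j`, the terms with `div v` drop out and `(v · ∇)v = -∇p` leaves
exactly the Neumann identity with `Δp = -∂ᵢvⱼ ∂ⱼvᵢ` (`neumann`). Compactly supported `φ` then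
identify the weak Laplacian (`hasWeakLaplacian`), which is unique a.e. (`HasWeakLaplacian.ae_eq`).
-/

lemma isOpen_disk : IsOpen disk := Metric.isOpen_ball

lemma measurableSet_disk : MeasurableSet disk := isOpen_disk.measurableSet

instance isFiniteMeasure_restrict_disk : IsFiniteMeasure (volume.restrict disk : Measure Plane) :=
  ⟨by simp [disk]⟩

/-! ### Classical partial derivatives -/

lemma contDiff_pderiv (j : Fin 2) {f : Plane → ℝ} (hf : ContDiff ℝ ∞ f) :
    ContDiff ℝ ∞ (pderiv j f) :=
  (hf.fderiv_right (m := ∞) (by simp)).clm_apply contDiff_const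

lemma pderiv_mul (j : Fin 2) {f g : Plane → ℝ} {x : Plane} (hf : DifferentiableAt ℝ f x)
    (hg : DifferentiableAt ℝ g x) :
    pderiv j (fun y => f y * g y) x = pderiv j f x * g x + f x * pderiv j g x := by
  simp only [pderiv, fderiv_fun_mul hf hg, add_apply, smul_apply, smul_eq_mul]
  ring

lemma pderiv_add_const (j : Fin 2) (f : Plane → ℝ) (c : ℝ) :
    pderiv j (fun y => f y + c) = pderiv j f := by
  ext x
  simp [pderiv]

lemma pderiv_pderiv (i j : Fin 2) {f : Plane → ℝ} (hf : ContDiff ℝ ∞ f) (x : Plane) :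
    pderiv i (pderiv j f) x =
      fderiv ℝ (fderiv ℝ f) x (EuclideanSpace.single i 1) (EuclideanSpace.single j 1) := by
  have hd : DifferentiableAt ℝ (fderiv ℝ f) x :=
    (hf.fderiv_right (m := ∞) (by simp)).differentiable (by simp) x
  have := fderiv_clm_apply hd (differentiableAt_const (EuclideanSpace.single j (1 : ℝ)))
  change fderiv ℝ (fun y => fderiv ℝ f y (EuclideanSpace.single j 1)) x _ = _
  rw [this]
  simp

lemma pderiv_comm (i j : Fin 2) {f : Plane → ℝ} (hf : ContDiff ℝ ∞ f) (x : Plane) :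
    pderiv i (pderiv j f) x = pderiv j (pderiv i f) x := by
  rw [pderiv_pderiv i j hf, pderiv_pderiv j i hf]
  have h2 : minSmoothness ℝ 2 ≤ ((⊤ : ℕ∞) : WithTop ℕ∞) := by
    rw [minSmoothness_of_isRCLikeNormedField]
    exact WithTop.coe_le_coe.2 (le_top : (2 : ℕ∞) ≤ ⊤)
  exact hf.contDiffAt.isSymmSndFDerivAt h2 _ _

lemma laplacian_eq_sum_pderiv {f : Plane → ℝ} (hf : ContDiff ℝ ∞ f) (x : Plane) :
    Laplacian.laplacian f x = ∑ j, pderiv j (pderiv j f) x := by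
  rw [InnerProductSpace.laplacian_eq_iteratedFDeriv_orthonormalBasis f
    (EuclideanSpace.basisFun (Fin 2) ℝ)]
  simp [pderiv_pderiv _ _ hf, iteratedFDeriv_two_apply]

/-! ### Test functions -/

namespace IsTestFunction

lemma pderiv {f : Plane → ℝ} (hf : IsTestFunction f) (j : Fin 2) :
    IsTestFunction (pderiv j f) where
  smooth := contDiff_pderiv j hf.smooth
  compact := hf.compact.fderiv_apply ℝ _
  support := (tsupport_fderiv_apply_subset ℝ _).trans hf.support

/-- The factor `φ` may be irregular outside the disk: off `tsupport f` the product vanishes locally.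
-/
lemma mul_left {f φ : Plane → ℝ} (hf : IsTestFunction f) (hφ : ContDiffOn ℝ ∞ φ disk) :
    IsTestFunction (fun x => φ x * f x) where
  smooth := by
    refine contDiff_iff_contDiffAt.2 fun x => ?_
    by_cases hx : x ∈ tsupport f
    · exact (hφ.contDiffAt (isOpen_disk.mem_nhds (hf.support hx))).mul hf.smooth.contDiffAt
    · have h0 : (fun x => φ x * f x) =ᶠ[𝓝 x] fun _ => 0 := by
        filter_upwards [notMem_tsupport_iff_eventuallyEq.1 hx] with y hy
        simp [hy]
      exact contDiffAt_const.congr_of_eventuallyEq h0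
  compact := hf.compact.mul_left
  support := (tsupport_mul_subset_right).trans hf.support

lemma eq_zero_of_notMem_disk {f : Plane → ℝ} (hf : IsTestFunction f) {x : Plane}
    (hx : x ∉ disk) : f x = 0 :=
  image_eq_zero_of_notMem_tsupport fun h => hx (hf.support h)

lemma integrable {f : Plane → ℝ} (hf : IsTestFunction f) : Integrable f :=
  hf.smooth.continuous.integrable_of_hasCompactSupport hf.compact

lemma memLp {f : Plane → ℝ} (hf : IsTestFunction f) (q : ENNReal) :
    MemLp f q (volume.restrict disk) :=
  (hf.smooth.continuous.memLp_of_hasCompactSupport hf.compact).restrict _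

lemma setIntegral_pderiv {f : Plane → ℝ} (hf : IsTestFunction f) (j : Fin 2) :
    ∫ x in disk, EulerDisk.pderiv j f x = 0 := by
  rw [setIntegral_eq_integral_of_forall_compl_eq_zero
    fun x hx => (hf.pderiv j).eq_zero_of_notMem_disk hx]
  have := integral_mul_fderiv_eq_neg_fderiv_mul_of_integrable (μ := (volume : Measure Plane))
    (f := fun _ : Plane => (1 : ℝ)) (g := f) (v := EuclideanSpace.single j 1)
    (by simp) (by simpa using! (hf.pderiv j).integrable) (by simpa using hf.integrable)
    (fun x _ => differentiableAt_const _) (fun x _ => hf.smooth.differentiable (by simp) x)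
  simpa using! this

lemma integrable_mul {f g : Plane → ℝ} (hf : IsTestFunction f) (hg : LocallyIntegrableOn g disk) :
    IntegrableOn (fun x => g x * f x) disk := by
  have h : IntegrableOn (fun x => f x * g x) (tsupport f) :=
    (hg.integrableOn_compact_subset hf.support hf.compact).continuousOn_mul
      hf.smooth.continuous.continuousOn hf.compact
  have h2 : Integrable (fun x => f x * g x) := by
    refine (integrableOn_iff_integrable_of_support_subset ?_).1 h
    exact fun x hx => subset_tsupport f (left_ne_zero_of_mul hx)
  simpa only [mul_comm] using h2.integrableOn

end IsTestFunction

/-! ### Functions smooth up to the boundary of the disk -/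

lemma memLp_top_of_continuousOn_closedBall {f : Plane → ℝ}
    (hf : ContinuousOn f (Metric.closedBall 0 1)) : MemLp f ⊤ (volume.restrict disk) := by
  obtain ⟨C, hC⟩ := (isCompact_closedBall (0 : Plane) 1).exists_bound_of_continuousOn hf
  refine memLp_top_of_bound
    ((hf.mono Metric.ball_subset_closedBall).aestronglyMeasurable measurableSet_disk) C ?_
  exact ae_restrict_of_forall_mem measurableSet_disk
    fun x hx => hC x (Metric.ball_subset_closedBall hx)

/-- On the circle `fderiv` may be a junk value; inside it agrees with `fderivWithin`, which is
continuous on the compact closed disk. -/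
lemma memLp_top_pderiv {φ : Plane → ℝ} (hφ : ContDiffOn ℝ ∞ φ (Metric.closedBall 0 1))
    (j : Fin 2) : MemLp (pderiv j φ) ⊤ (volume.restrict disk) := by
  have hu : UniqueDiffOn ℝ (Metric.closedBall (0 : Plane) 1) :=
    uniqueDiffOn_convex (convex_closedBall 0 1)
      ⟨0, mem_interior_iff_mem_nhds.2 (Metric.closedBall_mem_nhds _ one_pos)⟩
  have hc : ContinuousOn (fun x => fderivWithin ℝ φ (Metric.closedBall 0 1) x
      (EuclideanSpace.single j 1)) (Metric.closedBall 0 1) :=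
    (hφ.continuousOn_fderivWithin hu (by simp)).clm_apply continuousOn_const
  refine (memLp_congr_ae ?_).1 (memLp_top_of_continuousOn_closedBall hc)
  refine ae_restrict_of_forall_mem measurableSet_disk fun x hx => ?_
  simp only [pderiv]
  rw [fderivWithin_of_mem_nhds (Metric.closedBall_mem_nhds_of_mem hx)]

/-! ### Passing to the limit in integrals of products -/

section Limit

variable {α : Type*} {m : MeasurableSpace α} {μ : Measure α}

lemma integrable_mul_mul {g a b : α → ℝ} (hg : MemLp g ⊤ μ) (ha : MemLp a 2 μ)
    (hb : MemLp b 2 μ) : Integrable (fun x => g x * (a x * b x)) μ := by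
  have h : MemLp (fun x => a x * b x) 1 μ := hb.mul' ha
  exact memLp_one_iff_integrable.1 (h.mul' hg)

/-- This is continuity of the inner product of `L²`. -/
lemma tendsto_integral_mul {a b : α → ℝ} {A B : ℕ → α → ℝ} (ha : MemLp a 2 μ)
    (hb : MemLp b 2 μ) (hA : ∀ n, MemLp (A n) 2 μ) (hB : ∀ n, MemLp (B n) 2 μ)
    (hAa : Tendsto (fun n => eLpNorm (A n - a) 2 μ) atTop (𝓝 0))
    (hBb : Tendsto (fun n => eLpNorm (B n - b) 2 μ) atTop (𝓝 0)) :
    Tendsto (fun n => ∫ x, A n x * B n x ∂μ) atTop (𝓝 (∫ x, a x * b x ∂μ)) := by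
  have inner_eq : ∀ {f g : α → ℝ} (hf : MemLp f 2 μ) (hg : MemLp g 2 μ),
      inner ℝ (hf.toLp f) (hg.toLp g) = ∫ x, f x * g x ∂μ := by
    intro f g hf hg
    rw [L2.inner_def]
    refine integral_congr_ae ?_
    filter_upwards [hf.coeFn_toLp, hg.coeFn_toLp] with x hx hy
    rw [hx, hy]
    simp [mul_comm]
  have h := ((Lp.tendsto_Lp_iff_tendsto_eLpNorm'' A hA a ha).2 hAa).inner (𝕜 := ℝ)
    ((Lp.tendsto_Lp_iff_tendsto_eLpNorm'' B hB b hb).2 hBb)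
  simpa only [inner_eq] using h

/-- Multiplication by a bounded function is continuous on `L²`, so `g` can be absorbed into the
first factor. -/
lemma tendsto_integral_mul_mul {g a b : α → ℝ} {A B : ℕ → α → ℝ} (hg : MemLp g ⊤ μ)
    (ha : MemLp a 2 μ) (hb : MemLp b 2 μ) (hA : ∀ n, MemLp (A n) 2 μ)
    (hB : ∀ n, MemLp (B n) 2 μ)
    (hAa : Tendsto (fun n => eLpNorm (A n - a) 2 μ) atTop (𝓝 0))
    (hBb : Tendsto (fun n => eLpNorm (B n - b) 2 μ) atTop (𝓝 0)) :
    Tendsto (fun n => ∫ x, g x * (A n x * B n x) ∂μ) atTop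
      (𝓝 (∫ x, g x * (a x * b x) ∂μ)) := by
  have hgA : Tendsto (fun n => eLpNorm (g * A n - g * a) 2 μ) atTop (𝓝 0) := by
    have hlim := ENNReal.Tendsto.const_mul hAa (.inr hg.eLpNorm_ne_top)
    rw [mul_zero] at hlim
    refine tendsto_of_tendsto_of_tendsto_of_le_of_le tendsto_const_nhds hlim
      (fun _ => bot_le) fun n => ?_
    rw [← mul_sub, ← smul_eq_mul g]
    exact eLpNorm_smul_le_mul_eLpNorm (p := ⊤) (q := 2) (r := 2) ((hA n).sub ha).1 hg.1
  have := tendsto_integral_mul (ha.mul (r := 2) hg) hb (fun n => (hA n).mul (r := 2) hg) hB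
    hgA hBb
  simpa only [Pi.mul_apply, mul_assoc] using this

end Limit

/-! ### The weak form of the Jacobian identity -/

/-- Integrated against `φ`, the null Lagrangian `∂ᵢf ∂ⱼg - ∂ⱼf ∂ᵢg` is a divergence, without
boundary terms if `f` and `g` have compact support. -/
lemma setIntegral_jacobian_of_isTestFunction {f g φ : Plane → ℝ} (hf : IsTestFunction f)
    (hg : IsTestFunction g) (hφ : ContDiffOn ℝ ∞ φ disk) (c : ℝ) (i j : Fin 2) :
    ∫ x in disk, (pderiv i φ x * ((f x + c) * pderiv j g x)
      + φ x * (pderiv i f x * pderiv j g x)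
      - pderiv j φ x * ((f x + c) * pderiv i g x)
      - φ x * (pderiv j f x * pderiv i g x)) = 0 := by
  have hfc : ContDiff ℝ ∞ (fun x => f x + c) := hf.smooth.add contDiff_const
  have test : ∀ k, IsTestFunction (fun x => φ x * ((f x + c) * pderiv k g x)) :=
    fun k => ((hg.pderiv k).mul_left hfc.contDiffOn).mul_left hφ
  have expand : ∀ k l, ∀ x ∈ disk,
      pderiv l (fun x => φ x * ((f x + c) * pderiv k g x)) x =
        pderiv l φ x * ((f x + c) * pderiv k g x)
        + φ x * (pderiv l f x * pderiv k g x + (f x + c) * pderiv l (pderiv k g) x) := by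
    intro k l x hx
    have hdφ : DifferentiableAt ℝ φ x :=
      (hφ.contDiffAt (isOpen_disk.mem_nhds hx)).differentiableAt (by simp)
    have hdf : DifferentiableAt ℝ (fun x => f x + c) x := hfc.differentiable (by simp) x
    have hdg : DifferentiableAt ℝ (pderiv k g) x :=
      (hg.pderiv k).smooth.differentiable (by simp) x
    rw [pderiv_mul l hdφ (hdf.fun_mul hdg), pderiv_mul l hdf hdg, pderiv_add_const]
  calc _ = ∫ x in disk, (pderiv i (fun x => φ x * ((f x + c) * pderiv j g x)) x
        - pderiv j (fun x => φ x * ((f x + c) * pderiv i g x)) x) := by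
        refine setIntegral_congr_fun measurableSet_disk fun x hx => ?_
        -- The second derivatives of `g` cancel by symmetry.
        simp only [expand j i x hx, expand i j x hx, pderiv_comm i j hg.smooth]
        ring
    _ = 0 := by
        rw [integral_sub ((test j).pderiv i).integrable.integrableOn
          ((test i).pderiv j).integrable.integrableOn,
          (test j).setIntegral_pderiv i, (test i).setIntegral_pderiv j, sub_zero]

/-- The weak form of the Jacobian identity for Sobolev functions `f` and `g` with constant traces
on the circle, up to the boundary. -/
lemma setIntegral_jacobian {f g φ : Plane → ℝ} {Df Dg : Fin 2 → Plane → ℝ} {c d : ℝ}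
    (hf : IsW12Zero (fun x => f x - c) Df) (hg : IsW12Zero (fun x => g x - d) Dg)
    (hφ : ContDiffOn ℝ ∞ φ (Metric.closedBall 0 1)) (i j : Fin 2) :
    ∫ x in disk, (pderiv i φ x * (f x * Dg j x) + φ x * (Df i x * Dg j x)
      - pderiv j φ x * (f x * Dg i x) - φ x * (Df j x * Dg i x)) = 0 := by
  obtain ⟨F, hF, hFf, hFD⟩ := hf.approx
  -- Only the gradient of `g` enters, so neither `d` nor the `L²` convergence of `G` matters.
  obtain ⟨G, hG, -, hGD⟩ := hg.approx
  have hφ0 : MemLp φ ⊤ (volume.restrict disk) :=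
    memLp_top_of_continuousOn_closedBall hφ.continuousOn
  have hφ1 := memLp_top_pderiv hφ
  have hc : MemLp (fun _ : Plane => c) 2 (volume.restrict disk) := memLp_const c
  have hf2 : MemLp f 2 (volume.restrict disk) := by
    convert hf.isW12.memLp.add hc using 1
    ext x
    simp
  have hFc : ∀ n, MemLp (fun x => F n x + c) 2 (volume.restrict disk) :=
    fun n => ((hF n).memLp 2).add hc
  have hFf' : Tendsto (fun n => eLpNorm ((fun x => F n x + c) - f) 2 (volume.restrict disk))
      atTop (𝓝 0) := by
    refine hFf.congr fun n => ?_
    congr 1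
    ext x
    simp only [Pi.sub_apply]
    ring
  have hDf := hf.isW12.memLp_deriv
  have hDg := hg.isW12.memLp_deriv
  have hDF : ∀ k n, MemLp (pderiv k (F n)) 2 (volume.restrict disk) :=
    fun k n => ((hF n).pderiv k).memLp 2
  have hDG : ∀ k n, MemLp (pderiv k (G n)) 2 (volume.restrict disk) :=
    fun k n => ((hG n).pderiv k).memLp 2
  have lim := (((tendsto_integral_mul_mul (hφ1 i) hf2 (hDg j) hFc (hDG j) hFf' (hGD j)).add
    (tendsto_integral_mul_mul hφ0 (hDf i) (hDg j) (hDF i) (hDG j) (hFD i) (hGD j))).sub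
    (tendsto_integral_mul_mul (hφ1 j) hf2 (hDg i) hFc (hDG i) hFf' (hGD i))).sub
    (tendsto_integral_mul_mul hφ0 (hDf j) (hDg i) (hDF j) (hDG i) (hFD j) (hGD i))
  have split : ∀ {a Da Db Da' Db' : Plane → ℝ}, MemLp a 2 (volume.restrict disk) →
      MemLp Da 2 (volume.restrict disk) → MemLp Da' 2 (volume.restrict disk) →
      MemLp Db 2 (volume.restrict disk) → MemLp Db' 2 (volume.restrict disk) →
      ∫ x in disk, (pderiv i φ x * (a x * Db' x) + φ x * (Da x * Db' x)
        - pderiv j φ x * (a x * Db x) - φ x * (Da' x * Db x)) =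
      (∫ x in disk, pderiv i φ x * (a x * Db' x)) + (∫ x in disk, φ x * (Da x * Db' x))
        - (∫ x in disk, pderiv j φ x * (a x * Db x)) - ∫ x in disk, φ x * (Da' x * Db x) := by
    intro a Da Db Da' Db' ha hDa hDa' hDb hDb'
    have h1 := integrable_mul_mul (hφ1 i) ha hDb'
    have h2 := integrable_mul_mul hφ0 hDa hDb'
    have h3 := integrable_mul_mul (hφ1 j) ha hDb
    have h4 := integrable_mul_mul hφ0 hDa' hDb
    have h12 : Integrable (fun x => pderiv i φ x * (a x * Db' x) + φ x * (Da x * Db' x))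
        (volume.restrict disk) := h1.add h2
    have h123 : Integrable (fun x => pderiv i φ x * (a x * Db' x) + φ x * (Da x * Db' x)
        - pderiv j φ x * (a x * Db x)) (volume.restrict disk) := h12.sub h3
    rw [integral_sub h123 h4, integral_sub h12 h3, integral_add h1 h2]
  rw [split hf2 (hDf i) (hDf j) (hDg i) (hDg j)]
  refine tendsto_nhds_unique lim (tendsto_const_nhds.congr fun n => ?_)
  rw [← split (hFc n) (hDF i n) (hDF j n) (hDG i n) (hDG j n)]
  exact (setIntegral_jacobian_of_isTestFunction (hF n) (hG n)
    (hφ.mono Metric.ball_subset_closedBall) c i j).symm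

/-! ### The pressure -/

/-- The Laplacian `- ∂ⱼvᵢ ∂ᵢvⱼ` of the pressure. -/
def pressureLaplacian (Dv : Plane → Matrix (Fin 2) (Fin 2) ℝ) (x : Plane) : ℝ :=
  - ∑ i, ∑ j, Dv x j i * Dv x i j

namespace IsEulerSolution

variable {v : Plane → Plane} {Dv : Plane → Matrix (Fin 2) (Fin 2) ℝ} {p : Plane → ℝ}
  {Dp : Plane → Plane}

lemma memLp_deriv (h : IsEulerSolution v Dv p Dp) (i j : Fin 2) :
    MemLp (fun x => Dv x i j) 2 (volume.restrict disk) :=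
  (h.velocity i).memLp_deriv j

lemma pressure_gradient_ae (h : IsEulerSolution v Dv p Dp) (i : Fin 2) :
    (fun x => Dp x i) =ᵐ[volume.restrict disk] fun x => - ∑ j, v x j * Dv x i j := by
  filter_upwards [h.momentum] with x hx
  linarith [hx i]

/-- The momentum equation upgrades local to global integrability: each term is a product of two `L²`
functions. -/
lemma integrableOn_pressure_gradient (h : IsEulerSolution v Dv p Dp) : IntegrableOn Dp disk := by
  refine Integrable.of_eval_piLp fun i => ?_
  refine Integrable.congr ?_ (h.pressure_gradient_ae i).symm
  exact (integrable_finsetSum _ fun j _ => (h.velocity j).memLp.integrable_mul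
    (h.memLp_deriv i j)).neg

lemma integrableOn_pressureLaplacian (h : IsEulerSolution v Dv p Dp) :
    IntegrableOn (pressureLaplacian Dv) disk :=
  (integrable_finsetSum _ fun i _ => integrable_finsetSum _ fun j _ =>
    (h.memLp_deriv j i).integrable_mul (h.memLp_deriv i j)).neg

lemma integrableOn_gradient_mul (h : IsEulerSolution v Dv p Dp) {φ : Plane → ℝ}
    (hφ : ContDiffOn ℝ ∞ φ (Metric.closedBall 0 1)) :
    IntegrableOn (fun x => ∑ j, Dp x j * pderiv j φ x) disk := by
  refine integrable_finsetSum _ fun j _ => ?_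
  have hD : MemLp (fun x => Dp x j) 1 (volume.restrict disk) :=
    memLp_one_iff_integrable.2 (h.integrableOn_pressure_gradient.eval_piLp j)
  exact memLp_one_iff_integrable.1 ((memLp_top_pderiv hφ j).mul' hD)

lemma integrableOn_pressureLaplacian_mul (h : IsEulerSolution v Dv p Dp) {φ : Plane → ℝ}
    (hφ : ContDiffOn ℝ ∞ φ (Metric.closedBall 0 1)) :
    IntegrableOn (fun x => pressureLaplacian Dv x * φ x) disk :=
  memLp_one_iff_integrable.1 ((memLp_top_of_continuousOn_closedBall hφ.continuousOn).mul'
    (memLp_one_iff_integrable.2 h.integrableOn_pressureLaplacian))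

/-- The homogeneous Neumann condition for the pressure. -/
lemma neumann (h : IsEulerSolution v Dv p Dp) {φ : Plane → ℝ}
    (hφ : ContDiffOn ℝ ∞ φ (Metric.closedBall 0 1)) :
    ∫ x in disk, ∑ j, Dp x j * pderiv j φ x =
      - ∫ x in disk, pressureLaplacian Dv x * φ x := by
  have hφ0 : MemLp φ ⊤ (volume.restrict disk) :=
    memLp_top_of_continuousOn_closedBall hφ.continuousOn
  have hφ1 := memLp_top_pderiv hφ
  have hv := fun i => (h.velocity i).memLp
  have hD := h.memLp_deriv
  have hint : ∀ i j, Integrable (fun x => pderiv i φ x * (v x j * Dv x i j)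
      + φ x * (Dv x j i * Dv x i j) - pderiv j φ x * (v x j * Dv x i i)
      - φ x * (Dv x j j * Dv x i i)) (volume.restrict disk) := fun i j =>
    (((integrable_mul_mul (hφ1 i) (hv j) (hD i j)).add
      (integrable_mul_mul hφ0 (hD j i) (hD i j))).sub
      (integrable_mul_mul (hφ1 j) (hv j) (hD i i))).sub
      (integrable_mul_mul hφ0 (hD j j) (hD i i))
  have hzero := fun i j => setIntegral_jacobian (h.boundary j) (h.boundary i) hφ i j
  have hsum : ∫ x in disk, ∑ i, ∑ j, (pderiv i φ x * (v x j * Dv x i j)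
      + φ x * (Dv x j i * Dv x i j) - pderiv j φ x * (v x j * Dv x i i)
      - φ x * (Dv x j j * Dv x i i)) = 0 := by
    rw [integral_finsetSum _ fun i _ => integrable_finsetSum _ fun j _ => hint i j]
    refine Finset.sum_eq_zero fun i _ => ?_
    rw [integral_finsetSum _ fun j _ => hint i j]
    exact Finset.sum_eq_zero fun j _ => hzero i j
  rw [← add_eq_zero_iff_eq_neg, ← integral_add (h.integrableOn_gradient_mul hφ)
    (h.integrableOn_pressureLaplacian_mul hφ), ← neg_eq_zero, ← integral_neg, ← hsum]
  refine integral_congr_ae ?_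
  filter_upwards [h.divFree, h.momentum] with x hdiv hmom
  have h0 := hmom 0
  have h1 := hmom 1
  simp only [pressureLaplacian, Fin.sum_univ_two] at hdiv h0 h1 ⊢
  -- The momentum equation is tested with `-∇φ`; the leftover terms are `(v · ∇φ) div v + φ (div
  -- v)²`.
  linear_combination (-pderiv 0 φ x) * h0 - pderiv 1 φ x * h1
    + (pderiv 0 φ x * v x 0 + pderiv 1 φ x * v x 1 + φ x * (Dv x 0 0 + Dv x 1 1)) * hdiv

lemma hasWeakLaplacian (h : IsEulerSolution v Dv p Dp) :
    HasWeakLaplacian p (pressureLaplacian Dv) where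
  locInt := (h.pressure 0).locInt
  locInt_laplacian := h.integrableOn_pressureLaplacian.locallyIntegrableOn
  byParts := by
    intro φ hφ
    have hp : ∀ j, IntegrableOn (fun x => p x * pderiv j (pderiv j φ) x) disk :=
      fun j => ((hφ.pderiv j).pderiv j).integrable_mul (h.pressure j).locInt
    have hDp : ∀ j, IntegrableOn (fun x => Dp x j * pderiv j φ x) disk :=
      fun j => (hφ.pderiv j).integrable_mul (h.pressure j).locInt_deriv
    have hneu := h.neumann hφ.smooth.contDiffOn
    rw [integral_finsetSum _ fun j _ => hDp j] at hneu
    simp only [laplacian_eq_sum_pderiv hφ.smooth, Finset.mul_sum]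
    rw [integral_finsetSum _ fun j _ => hp j,
      Finset.sum_congr rfl fun j _ => (h.pressure j).byParts _ (hφ.pderiv j),
      Finset.sum_neg_distrib, hneu, neg_neg]

end IsEulerSolution

/-- By the fundamental lemma of the calculus of variations; this carries the Neumann identity over
to an arbitrary representative of the Laplacian. -/
lemma HasWeakLaplacian.ae_eq {f g₁ g₂ : Plane → ℝ} (h₁ : HasWeakLaplacian f g₁)
    (h₂ : HasWeakLaplacian f g₂) : g₁ =ᵐ[volume.restrict disk] g₂ := by
  have key := isOpen_disk.ae_eq_zero_of_integral_contDiff_smul_eq_zero (μ := volume)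
    (f := g₁ - g₂) (h₁.locInt_laplacian.sub h₂.locInt_laplacian) ?_
  · refine (ae_restrict_iff' measurableSet_disk).2 ?_
    filter_upwards [key] with x hx hxd
    exact sub_eq_zero.1 (hx hxd)
  · intro φ hs hc ht
    have hφ : IsTestFunction φ := ⟨hs, hc, ht⟩
    rw [← setIntegral_eq_integral_of_forall_compl_eq_zero (s := disk)
      fun x hx => by rw [hφ.eq_zero_of_notMem_disk hx, zero_smul]]
    simp only [Pi.sub_apply, smul_eq_mul, mul_comm (φ _), sub_mul]
    rw [integral_sub (hφ.integrable_mul h₁.locInt_laplacian)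
      (hφ.integrable_mul h₂.locInt_laplacian), ← h₁.byParts φ hφ, ← h₂.byParts φ hφ, sub_self]

end EulerDisk

open EulerDisk
theorem lemma3p2 (v : Plane → Plane) (Dv : Plane → Matrix (Fin 2) (Fin 2) ℝ)
    (p : Plane → ℝ) (Dp : Plane → Plane) (h : IsEulerSolution v Dv p Dp) :
    IntegrableOn Dp disk ∧
    (∃ lap : Plane → ℝ, IntegrableOn lap disk ∧ HasWeakLaplacian p lap) ∧
    ∀ lap : Plane → ℝ, HasWeakLaplacian p lap →
      ∀ φ : Plane → ℝ, ContDiffOn ℝ ∞ φ (Metric.closedBall 0 1) →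
        IntegrableOn (fun x => ∑ j, Dp x j * pderiv j φ x) disk ∧
        IntegrableOn (fun x => lap x * φ x) disk ∧
        ∫ x in disk, ∑ j, Dp x j * pderiv j φ x = - ∫ x in disk, lap x * φ x := by
  refine ⟨h.integrableOn_pressure_gradient,
    ⟨_, h.integrableOn_pressureLaplacian, h.hasWeakLaplacian⟩, fun lap hlap φ hφ => ?_⟩
  have hae : (fun x => pressureLaplacian Dv x * φ x) =ᵐ[volume.restrict disk]
      fun x => lap x * φ x := by
    filter_upwards [h.hasWeakLaplacian.ae_eq hlap] with x hx
    rw [hx]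
  refine ⟨h.integrableOn_gradient_mul hφ, (h.integrableOn_pressureLaplacian_mul hφ).congr hae, ?_⟩
  rw [← integral_congr_ae hae]
  exact h.neumann hφ
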